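/- Let $n\ge 0$ be an integer, let $0<\zeta_1<\dots<\zeta_n$ and $b_1(0),\dots,b_n(0)>0$ be real numbers, and put $$b_j(t)=b_j(0)e^{\zeta_j t},\qquad f_i(t)=\sum_{j=1}^n\zeta_j^{\,i}\,b_j(t)\qquad(i=0,1,2,\dots,\ t\in\mathbb R).$$ For a real number $\alpha\ge 0$ define, for integers $i,j\ge 0$, skew-symmetric Pfaffian entries $$(d_0,i)=f_i(t),\qquad (i,j)=e^{-\alpha t}\iint_{-\infty<t_1<t_2<t}e^{\alpha t_2}\bigl[f_{i+1}(t_1)f_{j+1}(t_2)-f_{i+1}(t_2)f_{j+1}(t_1)\bigr]\,dt_1\,dt_2 ,$$ and for $k\in\mathbb Z$ define functions of $t$ by the Pfaffians $$\tilde\tau_{2k}=(0,1,\dots,2k-1),\qquad \tilde\tau_{2k-1}=(d_0,0,1,\dots,2k-2),\qquad \tilde\tau_0=1,\qquad \tilde\tau_k=0\ \text{ for }k<0 .$$ Here $(a_1,\dots,a_{2N})=\sum_P(-1)^P(a_{i_1},a_{i_2})\cdots(a_{i_{2N-1}},a_{i_{2N}})$, the sum being over the permutations $i_1,\dots,i_{2N}$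 of $1,\dots,2N$ with $i_{2l-1}<i_{2l}$ and $i_{2l-1}<i_{2l+1}$, and $(-1)^P$ being the sign of the permutation. Then, for every $\alpha\ge0$, the double integrals above converge absolutely, the functions $\tilde\tau_{-1},\dots,\tilde\tau_{n+1}$ are twice continuously differentiable on $\mathbb R$, and $\{\tilde\tau_k\}_{k=0}^n$ satisfy the generalized finite bilinear B-Toda lattice $$\ddot{\tilde\tau}_k\tilde\tau_k-(\dot{\tilde\tau}_k)^2=\dot{\tilde\tau}_{k+1}\tilde\tau_{k-1}-\tilde\tau_{k+1}\dot{\tilde\tau}_{k-1}+\alpha\,\tilde\tau_{k+1}\tilde\tau_{k-1},\qquad k=0,1,\dots,n,$$ with $\tilde\tau_{-1}=0$ and $\tilde\tau_{n+1}=0$. For $\alpha=0$ this reduces to the B-Toda result: the generalized lattice with $\alpha=0$ is the finite bilinear B-Toda lattice $$\ddot\tau_k\tau_k-(\dot\tau_k)^2=\tau_{k-1}\dot\tau_{k+1}-\dot\tau_{k-1}\tau_{k+1},\qquad k=0,1,\dots,n,\qquad \tau_{-1}=\tau_{n+1}=0;$$ for $\alpha=0$ and all $k\in\mathbb Z$ one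 has $\tilde\tau_k=\tau_k$, where $$\tau_k=\sum_{J\subseteq\{1,\dots,n\},\,|J|=k}\Bigl(\prod_{j\in J}b_j\Bigr)\frac{\prod_{i,j\in J,\,i<j}(\zeta_j-\zeta_i)^2}{\prod_{i,j\in J,\,i<j}(\zeta_j+\zeta_i)}\quad(k\ge0),\qquad \tau_k=0\quad(k<0);$$ and these $\tau_k$ are twice continuously differentiable and satisfy the finite bilinear B-Toda lattice. -/

import Mathlib

noncomputable section

namespace BToda

open scoped BigOperators

/-- The Pfaffian of order `N` of a `2N × 2N` skew-symmetric array `A`: the signed sum of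
`A(i₁,i₂) A(i₃,i₄) ⋯ A(i_{2N-1},i_{2N})` over all rearrangements `i = σ` of the index set with
`i_{2l-1} < i_{2l}` and `i_1 < i_3 < i_5 < ⋯` (here numbered from `0`). -/
def pfaffian (N : ℕ) (A : Matrix (Fin (2 * N)) (Fin (2 * N)) ℝ) : ℝ :=
  ∑ σ : Equiv.Perm (Fin (2 * N)) with
      (∀ l : Fin N, σ ⟨2 * l, by omega⟩ < σ ⟨2 * l + 1, by omega⟩) ∧
      (∀ l m : Fin N, l < m → σ ⟨2 * l, by omega⟩ < σ ⟨2 * m, by omega⟩),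
    ((Equiv.Perm.sign σ : ℤ) : ℝ) *
      ∏ l : Fin N, A (σ ⟨2 * l, by omega⟩) (σ ⟨2 * l + 1, by omega⟩)

/-- `b_j(t) = b_j(0) e^{ζ_j t}`. -/
def b {n : ℕ} (ζ b₀ : Fin n → ℝ) (j : Fin n) (t : ℝ) : ℝ :=
  b₀ j * Real.exp (ζ j * t)

/-- `f_i(t) = ∑_j ζ_j^i b_j(t)`. -/
def f {n : ℕ} (ζ b₀ : Fin n → ℝ) (i : ℕ) (t : ℝ) : ℝ :=
  ∑ j : Fin n, ζ j ^ i * b ζ b₀ j t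

/-- The domain `-∞ < t₁ < t₂ < t`. -/
def region (t : ℝ) : Set (ℝ × ℝ) :=
  {p | p.1 < p.2 ∧ p.2 < t}

/-- `e^{α t₂} [f_{i+1}(t₁) f_{j+1}(t₂) - f_{i+1}(t₂) f_{j+1}(t₁)]` at `p = (t₁, t₂)`. -/
def integrand {n : ℕ} (ζ b₀ : Fin n → ℝ) (α : ℝ) (i j : ℕ) (p : ℝ × ℝ) : ℝ :=
  Real.exp (α * p.2) *
    (f ζ b₀ (i + 1) p.1 * f ζ b₀ (j + 1) p.2 - f ζ b₀ (i + 1) p.2 * f ζ b₀ (j + 1) p.1)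

/-- The Pfaffian entries. The symbol `d₀` is `none`, the index `i` is `some i`:
`(d₀, i) = f_i(t)` and
`(i, j) = e^{-α t} ∬_{-∞<t₁<t₂<t} e^{α t₂} [f_{i+1}(t₁) f_{j+1}(t₂) - f_{i+1}(t₂) f_{j+1}(t₁)]`. -/
def entry {n : ℕ} (ζ b₀ : Fin n → ℝ) (α t : ℝ) : Option ℕ → Option ℕ → ℝ
  | none, none => 0
  | none, some i => f ζ b₀ i t
  | some i, none => -f ζ b₀ i t
  | some i, some j =>
      Real.exp (-(α * t)) * ∫ p in region t, integrand ζ b₀ α i j p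

/-- The sequence `0, 1, 2, …` of symbols. -/
def evenSymbols (i : ℕ) : Option ℕ := some i

/-- The sequence `d₀, 0, 1, 2, …` of symbols. -/
def oddSymbols : ℕ → Option ℕ
  | 0 => none
  | i + 1 => some i

/-- The Pfaffian `(s₀, s₁, …, s_{2N-1})` in the entries above. -/
def symbolPfaffian {n : ℕ} (ζ b₀ : Fin n → ℝ) (α t : ℝ) (N : ℕ) (s : ℕ → Option ℕ) : ℝ :=
  pfaffian N (Matrix.of fun i j => entry ζ b₀ α t (s i) (s j))

/-- The functions `τ̃_k`: `τ̃_{2m} = (0, …, 2m-1)`, `τ̃_{2m-1} = (d₀, 0, …, 2m-2)`,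
and `τ̃_k = 0` for `k < 0`. -/
def tauTilde {n : ℕ} (ζ b₀ : Fin n → ℝ) (α : ℝ) (k : ℤ) (t : ℝ) : ℝ :=
  if k < 0 then 0
  else if Even k then symbolPfaffian ζ b₀ α t (k / 2).toNat evenSymbols
  else symbolPfaffian ζ b₀ α t ((k + 1) / 2).toNat oddSymbols

/-- The undeformed functions `τ_k = ∑_{|J| = k} b_J Δ_J² / Γ_J`, with `τ_k = 0` for `k < 0`. -/
def tau {n : ℕ} (ζ b₀ : Fin n → ℝ) (k : ℤ) (t : ℝ) : ℝ :=
  if k < 0 then 0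
  else ∑ J ∈ (Finset.univ : Finset (Fin n)).powersetCard k.toNat,
    (∏ j ∈ J, b ζ b₀ j t) *
      (∏ i ∈ J, ∏ j ∈ J with i < j, (ζ j - ζ i)) ^ 2 /
      (∏ i ∈ J, ∏ j ∈ J with i < j, (ζ j + ζ i))

/-- `τ_{-1}, …, τ_{n+1}` are twice continuously differentiable functions on the line that satisfy
the generalized finite bilinear B-Toda lattice with parameter `α`, including the boundary
conditions. -/
structure SolvesGeneralizedBToda (n : ℕ) (α : ℝ) (τ : ℤ → ℝ → ℝ) : Prop where
  contDiff : ∀ k : ℤ, -1 ≤ k → k ≤ n + 1 → ContDiff ℝ 2 (τ k)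
  left_boundary : ∀ t, τ (-1) t = 0
  right_boundary : ∀ t, τ (n + 1) t = 0
  equation : ∀ k : ℤ, 0 ≤ k → k ≤ n → ∀ t : ℝ,
    deriv (deriv (τ k)) t * τ k t - deriv (τ k) t ^ 2 =
      deriv (τ (k + 1)) t * τ (k - 1) t - τ (k + 1) t * deriv (τ (k - 1)) t
        + α * τ (k + 1) t * τ (k - 1) t

/-- `τ_{-1}, …, τ_{n+1}` are twice continuously differentiable functions on the line that satisfy
the finite bilinear B-Toda lattice, including the boundary conditions. -/
structure SolvesBToda (n : ℕ) (τ : ℤ → ℝ → ℝ) : Prop where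
  contDiff : ∀ k : ℤ, -1 ≤ k → k ≤ n + 1 → ContDiff ℝ 2 (τ k)
  left_boundary : ∀ t, τ (-1) t = 0
  right_boundary : ∀ t, τ (n + 1) t = 0
  equation : ∀ k : ℤ, 0 ≤ k → k ≤ n → ∀ t : ℝ,
    deriv (deriv (τ k)) t * τ k t - deriv (τ k) t ^ 2 =
      τ (k - 1) t * deriv (τ (k + 1)) t - deriv (τ (k - 1)) t * τ (k + 1) t

end BToda

end

/-!
The functions `τ̃_k` are values of one linear functional on the exterior algebra of `ℝⁿ`.
Evaluating the double integrals gives `(i, j) = B (v i) (v j)` and `(d₀, i) = δ₀ (v i)`, where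
`v i = (ζ_r ^ i b_r(t))_r` (`momentVec`), `B` is the alternating form with matrix
`(ζ_s - ζ_r) / (ζ_s + ζ_r + α)` (`cauchyForm`) and `δ_i x = ∑ ζ_r ^ i x_r` (`powerFunctional`). Let
`P` be the functional with `P (v ∧ x) = P (B v ⌋ x)` (`pfaffianFunctional`), so that Pfaffians of
values of `B` are values of `P` at products of vectors. Then `τ̃_k` is `P X` for even `k` and
`P (δ₀ ⌋ X)` for odd `k`, with `X = v 0 ∧ ⋯ ∧ v (k-1)` (`tauTilde_eq_ιMulti`). In particular
`τ̃_{n+1} = 0`, because `n + 1` vectors of `ℝⁿ` are linearly dependent.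

As `v i` has derivative `v (i+1)`, differentiation in time is a derivation `D` of the exterior
algebra with `D X = v 0 ∧ ⋯ ∧ v (k-2) ∧ v k`. On the other hand, multiplication by `ζ_s + ζ_r + α`
clears the denominators of `B`, which gives `P (D x) = -(α/2) deg x · P x + P (δ₁ ⌋ δ₀ ⌋ x)`
(`pfaffianFunctional_weightDerivation_eq`). Using the first description of the derivative for one
factor and the second one for the other, each equation of the lattice becomes a four-letter Plücker
relation (`plucker_odd`, `plucker_even`). Both relations are special cases of
`pfaffianFunctional_plucker`, in which all terms with a repeated letter vanish.

For `α = 0`, expanding `X` in the standard basis produces Vandermonde determinants, and the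
remaining values of `P` at products of basis vectors are Schur's Pfaffians
`∏_{i<j} (ζ_j - ζ_i) / (ζ_j + ζ_i)` (`pfaffianFunctional_eq_schurProd`). These follow by induction
from the expansion along the first row, which is a partial fraction expansion obtained from
Lagrange interpolation.
-/

noncomputable section

namespace BToda

open CliffordAlgebra (contractLeft contractLeft_comm)
open ExteriorAlgebra (ι ιMulti)

/-! ### The Pfaffian functional and its Plücker relations -/

section General

variable {R M : Type*} [CommRing R] [AddCommGroup M] [Module R M]

/-- The linear functional on the exterior algebra attached to an alternating form `B`: on
`v₁ ∧ ⋯ ∧ v_k` it takes the value of the Pfaffian of the array `B (v i) (v j)` (and `0` for odd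
`k`). It is the scalar part of the exponential of the contraction with `B`, which in Mathlib is
`CliffordAlgebra.changeForm` between two copies of the exterior algebra; the sign of `-B` makes up
for the minus sign in `CliffordAlgebra.changeForm_ι_mul`. -/
def pfaffianFunctional (B : LinearMap.BilinForm R M) (hB : B.IsAlt) :
    ExteriorAlgebra R M →ₗ[R] R :=
  ExteriorAlgebra.algebraMapInv.toLinearMap ∘ₗ
    CliffordAlgebra.changeForm (B := -B) (Q := 0) (Q' := 0)
      (by ext v; simp [hB v])

variable {B : LinearMap.BilinForm R M} (hB : B.IsAlt)

/-- `CliffordAlgebra.contractLeft_ι_mul` in terms of `ExteriorAlgebra.ι`. -/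
lemma contractLeft_ι_mul (d : Module.Dual R M) (a : M) (x : ExteriorAlgebra R M) :
    contractLeft d (ι R a * x) = d a • x - ι R a * contractLeft d x :=
  CliffordAlgebra.contractLeft_ι_mul d a x

@[simp]
lemma pfaffianFunctional_one : pfaffianFunctional B hB 1 = 1 := by
  simp [pfaffianFunctional]

/-- Expansion along the first vector. -/
lemma pfaffianFunctional_ι_mul (v : M) (x : ExteriorAlgebra R M) :
    pfaffianFunctional B hB (ι R v * x) = pfaffianFunctional B hB (contractLeft (B v) x) := by
  simp only [pfaffianFunctional, LinearMap.comp_apply, CliffordAlgebra.changeForm_contractLeft]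
  rw [CliffordAlgebra.changeForm_ι_mul]
  simp [ExteriorAlgebra.algebraMapInv]

/-- The functional `v ↦ g (v ∧ x)`. -/
def wedgeFunctional (g : ExteriorAlgebra R M →ₗ[R] R) (x : ExteriorAlgebra R M) :
    Module.Dual R M :=
  g ∘ₗ LinearMap.mulRight R x ∘ₗ ι R

/-- The functional `v ↦ g (B v ⌋ y)`. -/
def contractFunctional (B : LinearMap.BilinForm R M) (g : ExteriorAlgebra R M →ₗ[R] R)
    (y : ExteriorAlgebra R M) : Module.Dual R M :=
  g ∘ₗ (contractLeft (Q := (0 : QuadraticForm R M))).flip y ∘ₗ B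

@[simp]
lemma wedgeFunctional_apply (g : ExteriorAlgebra R M →ₗ[R] R) (x : ExteriorAlgebra R M) (v : M) :
    wedgeFunctional g x v = g (ι R v * x) := rfl

@[simp]
lemma contractFunctional_apply (g : ExteriorAlgebra R M →ₗ[R] R) (y : ExteriorAlgebra R M)
    (v : M) : contractFunctional B g y v = g (contractLeft (B v) y) := rfl

/-- The general Plücker relation for Pfaffians, with one of the two Pfaffians replaced by an
arbitrary functional `g`. For products `x` and `y` of vectors `x i` and `y j`, both sides are the
signed double sum of `B (x i) (y j)` times the Pfaffian of `x` without `x i` times the value of `g`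
at `y` without `y j`. -/
theorem pfaffianFunctional_plucker (x y : ExteriorAlgebra R M)
    (g : ExteriorAlgebra R M →ₗ[R] R) :
    pfaffianFunctional B hB (contractLeft (contractFunctional B g y) x) =
      -g (contractLeft (wedgeFunctional (pfaffianFunctional B hB) x) y) := by
  induction y using CliffordAlgebra.left_induction generalizing g with
  | algebraMap r =>
    have : contractFunctional B g (algebraMap R _ r) = 0 := by
      ext v; simp
    rw [this]; simp
  | add y z hy hz =>
    have : contractFunctional B g (y + z) =
        contractFunctional B g y + contractFunctional B g z := by
      ext v; simp
    rw [this, map_add, LinearMap.add_apply, map_add, hy, hz, map_add, map_add]; ring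
  | ι_mul y b hy =>
    have : contractFunctional B g (ι R b * y) =
        -(g y • B b) - contractFunctional B (g ∘ₗ LinearMap.mulLeft R (ι R b)) y := by
      ext v
      have hs : B v b = -B b v := (hB.neg_eq b v).symm
      simp only [contractFunctional_apply, LinearMap.sub_apply, LinearMap.neg_apply,
        LinearMap.smul_apply, LinearMap.comp_apply, LinearMap.mulLeft_apply, smul_eq_mul]
      rw [contractLeft_ι_mul, map_sub, map_smul, hs, smul_eq_mul]
      ring
    change pfaffianFunctional B hB (contractLeft (contractFunctional B g (ι R b * y)) x) =
      -g (contractLeft (wedgeFunctional (pfaffianFunctional B hB) x) (ι R b * y))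
    rw [this, map_sub, LinearMap.sub_apply, map_sub, hy, map_neg, LinearMap.neg_apply, map_smul,
      LinearMap.smul_apply, map_neg, map_smul, ← pfaffianFunctional_ι_mul, contractLeft_ι_mul]
    simp only [wedgeFunctional_apply, LinearMap.comp_apply, LinearMap.mulLeft_apply, map_sub,
      map_smul, smul_eq_mul]
    ring

/-- The product `v_{k-1} ∧ ⋯ ∧ v₁ ∧ v₀`, with the newest vector on the left. -/
def descWedge (v : ℕ → M) : ℕ → ExteriorAlgebra R M
  | 0 => 1
  | k + 1 => ι R (v k) * descWedge v k

lemma ι_mul_ι_comm (a b : M) (x : ExteriorAlgebra R M) :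
    ι R a * (ι R b * x) = -(ι R b * (ι R a * x)) := by
  rw [← mul_assoc, ← mul_assoc, ← neg_mul]
  congr 1
  exact eq_neg_of_add_eq_zero_left (ExteriorAlgebra.ι_add_mul_swap a b)

lemma ι_mul_descWedge_of_lt (v : ℕ → M) {i k : ℕ} (h : i < k) :
    ι R (v i) * descWedge v k = 0 := by
  induction k with
  | zero => omega
  | succ k ih =>
    rw [descWedge]
    rcases Nat.lt_succ_iff_lt_or_eq.mp h with h | rfl
    · rw [ι_mul_ι_comm, ih h, mul_zero, neg_zero]
    · rw [← mul_assoc, ExteriorAlgebra.ι_sq_zero, zero_mul]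

lemma contractLeft_descWedge_congr (v : ℕ → M) (d d' : Module.Dual R M) (k : ℕ)
    (h : ∀ i < k, d (v i) = d' (v i)) :
    contractLeft d (descWedge v k) = contractLeft d' (descWedge v k) := by
  induction k with
  | zero => simp [descWedge]
  | succ k ih =>
    rw [descWedge, contractLeft_ι_mul, contractLeft_ι_mul, h k (by omega),
      ih fun i hi => h i (by omega)]

lemma contractLeft_descWedge_eq_zero (v : ℕ → M) (d : Module.Dual R M) (k : ℕ)
    (h : ∀ i < k, d (v i) = 0) : contractLeft d (descWedge v k) = 0 := by
  rw [contractLeft_descWedge_congr v d 0 k h, map_zero, LinearMap.zero_apply]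

lemma descWedge_mul_ι (v : ℕ → M) (k : ℕ) (a : M) :
    descWedge v k * ι R a = (-1) ^ k * (ι R a * descWedge v k) := by
  induction k with
  | zero => simp [descWedge]
  | succ k ih =>
    have hc : ∀ x : ExteriorAlgebra R M, (-1) ^ k * x = ((-1) ^ k : R) • x := by
      intro x; simp [Algebra.smul_def]
    rw [descWedge, mul_assoc, ih, ι_mul_ι_comm, pow_succ, hc, mul_assoc, hc]
    simp

/-- The sign of the permutation reversing `k` objects. -/
def reversalSign (R : Type*) [CommRing R] : ℕ → R
  | 0 => 1
  | k + 1 => (-1) ^ k * reversalSign R k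

lemma reversalSign_sq (k : ℕ) : reversalSign R k * reversalSign R k = 1 := by
  induction k with
  | zero => simp [reversalSign]
  | succ k ih =>
    rw [reversalSign, mul_mul_mul_comm, ih, ← mul_pow]; simp

lemma reversalSign_add_two (k : ℕ) : reversalSign R (k + 2) = -reversalSign R k := by
  rw [reversalSign, reversalSign, ← mul_assoc, ← pow_add, show k + 1 + k = 2 * k + 1 by ring]
  simp [pow_succ, pow_mul]

lemma ιMulti_eq_reversalSign_smul_descWedge (v : ℕ → M) (k : ℕ) :
    ιMulti R k (fun i : Fin k => v i) = reversalSign R k • descWedge v k := by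
  induction k with
  | zero => simp [reversalSign, descWedge]
  | succ k ih =>
    have h : ιMulti R (k + 1) (fun i : Fin (k + 1) => v i) =
        ιMulti R k (fun i : Fin k => v i) * ι R (v k) := by
      rw [ExteriorAlgebra.ιMulti_apply, List.ofFn_succ', List.concat_eq_append, List.prod_append,
        ExteriorAlgebra.ιMulti_apply]
      simp
    rw [h, ih, smul_mul_assoc, descWedge_mul_ι, reversalSign, descWedge, mul_comm, mul_smul]
    congr 1
    simp [Algebra.smul_def]

/-- Expansion of the contraction of a product of vectors. -/
lemma contractLeft_ιMulti (d : Module.Dual R M) (k : ℕ) (v : Fin (k + 1) → M) :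
    contractLeft d (ιMulti R (k + 1) v) =
      ∑ j : Fin (k + 1), ((-1) ^ (j : ℕ) * d (v j)) • ιMulti R k (fun i => v (j.succAbove i)) := by
  induction k with
  | zero =>
    rw [ExteriorAlgebra.ιMulti_succ_apply, contractLeft_ι_mul]
    simp
  | succ k ih =>
    rw [ExteriorAlgebra.ιMulti_succ_apply, contractLeft_ι_mul, ih, Fin.sum_univ_succ (n := k + 1),
      Finset.mul_sum, sub_eq_add_neg, ← Finset.sum_neg_distrib]
    congr 1
    · simp [Matrix.vecTail, Function.comp_def]
    · refine Finset.sum_congr rfl fun j _ => ?_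
      rw [ExteriorAlgebra.ιMulti_succ_apply]
      simp [Matrix.vecTail, Function.comp_def, pow_succ]

/-- Plücker relation for four letters, of which two are vectors `a`, `b` and two are the
functionals `d`, `d'`, next to common letters `v 0, …, v (k-1)`. All factors vanish unless `k` is
odd. -/
theorem plucker_odd (v : ℕ → M) (k : ℕ) (a b : M) (d d' : Module.Dual R M) :
    pfaffianFunctional B hB (ι R b * descWedge v k) *
        pfaffianFunctional B hB (contractLeft d' (contractLeft d (ι R a * descWedge v k))) -
      pfaffianFunctional B hB (ι R a * descWedge v k) *
        pfaffianFunctional B hB (contractLeft d' (contractLeft d (ι R b * descWedge v k))) =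
    pfaffianFunctional B hB (contractLeft d' (ι R b * (ι R a * descWedge v k))) *
        pfaffianFunctional B hB (contractLeft d (descWedge v k)) -
      pfaffianFunctional B hB (contractLeft d (ι R b * (ι R a * descWedge v k))) *
        pfaffianFunctional B hB (contractLeft d' (descWedge v k)) := by
  set P := pfaffianFunctional B hB with hP
  set ω := descWedge (R := R) v k with hω
  obtain ⟨A, hA⟩ : ∃ A, A = ι R b * (ι R a * ω) := ⟨_, rfl⟩
  rw [← hA]
  have hvA : ∀ i < k, ι R (v i) * A = 0 := fun i hi => by
    rw [hA, ι_mul_ι_comm, ι_mul_ι_comm (v i) a, ι_mul_descWedge_of_lt v hi]; simp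
  have key := pfaffianFunctional_plucker hB ω A (P ∘ₗ contractLeft d' ∘ₗ contractLeft d)
  -- A repeated letter kills the product, so only the letters outside `ω` contribute below.
  have h1 : contractLeft (wedgeFunctional P ω) ω = 0 :=
    contractLeft_descWedge_eq_zero v _ k fun i hi => by
      rw [wedgeFunctional_apply, hω, ι_mul_descWedge_of_lt v hi, map_zero]
  have h2 : contractLeft (contractFunctional B (P ∘ₗ contractLeft d' ∘ₗ contractLeft d) A) ω =
      contractLeft (P (contractLeft d A) • d' - P (contractLeft d' A) • d) ω :=
    contractLeft_descWedge_congr v _ _ k fun i hi => by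
      have h0 : contractLeft d' (contractLeft d (ι R (v i) * A)) = 0 := by
        rw [hvA i hi, map_zero, map_zero]
      rw [contractLeft_ι_mul, map_sub, map_smul, contractLeft_ι_mul d'] at h0
      have h0' := congrArg P h0
      simp only [map_sub, map_smul, map_zero, smul_eq_mul] at h0'
      simp only [contractFunctional_apply, LinearMap.comp_apply, LinearMap.sub_apply,
        LinearMap.smul_apply, smul_eq_mul]
      rw [contractLeft_comm (x := A), map_neg, contractLeft_comm d' (B (v i)), neg_neg, hP,
        ← pfaffianFunctional_ι_mul, ← hP]
      linear_combination h0'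
  rw [h2, ← hP, hA, contractLeft_ι_mul (wedgeFunctional P ω),
    contractLeft_ι_mul (wedgeFunctional P ω), h1, ← hA] at key
  simp only [map_sub, LinearMap.sub_apply, map_smul, LinearMap.smul_apply, LinearMap.comp_apply,
    smul_eq_mul, mul_zero, sub_zero, wedgeFunctional_apply, mul_smul_comm] at key
  linear_combination key

/-- Plücker relation for four letters, of which two are vectors `a`, `b` and two are the
functionals `d`, `d'`, next to common letters `v 0, …, v (k-1)`. All factors vanish unless `k` is
even. -/
theorem plucker_even (v : ℕ → M) (k : ℕ) (a b : M) (d d' : Module.Dual R M) :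
    pfaffianFunctional B hB (contractLeft d (ι R b * descWedge v k)) *
        pfaffianFunctional B hB (contractLeft d' (ι R a * descWedge v k)) -
      pfaffianFunctional B hB (contractLeft d (ι R a * descWedge v k)) *
        pfaffianFunctional B hB (contractLeft d' (ι R b * descWedge v k)) =
    pfaffianFunctional B hB (descWedge v k) *
        pfaffianFunctional B hB
          (contractLeft d' (contractLeft d (ι R b * (ι R a * descWedge v k)))) -
      pfaffianFunctional B hB (ι R b * (ι R a * descWedge v k)) *
        pfaffianFunctional B hB (contractLeft d' (contractLeft d (descWedge v k))) := by
  set P := pfaffianFunctional B hB with hP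
  set ω := descWedge (R := R) v k with hω
  obtain ⟨A, hA⟩ : ∃ A, A = ι R b * (ι R a * ω) := ⟨_, rfl⟩
  rw [← hA]
  have hvA : ∀ i < k, ι R (v i) * A = 0 := fun i hi => by
    rw [hA, ι_mul_ι_comm, ι_mul_ι_comm (v i) a, ι_mul_descWedge_of_lt v hi]; simp
  have key := pfaffianFunctional_plucker hB (contractLeft d ω) A (P ∘ₗ contractLeft d')
  set f := wedgeFunctional (P ∘ₗ contractLeft d) ω with hf
  -- A repeated letter kills the product, so only the letters outside `ω` contribute below.
  have h1 : contractLeft f ω = 0 :=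
    contractLeft_descWedge_eq_zero v _ k fun i hi => by
      rw [hf, wedgeFunctional_apply, hω, ι_mul_descWedge_of_lt v hi, map_zero]
  have h3 : wedgeFunctional P (contractLeft d ω) = P ω • d - f := by
    ext u
    simp only [hf, wedgeFunctional_apply, LinearMap.comp_apply, LinearMap.sub_apply,
      LinearMap.smul_apply, contractLeft_ι_mul, map_sub, map_smul, smul_eq_mul]
    ring
  have h2 : contractLeft (contractFunctional B (P ∘ₗ contractLeft d') A) ω =
      contractLeft (-(P A • d')) ω :=
    contractLeft_descWedge_congr v _ _ k fun i hi => by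
      have h0 : contractLeft d' (ι R (v i) * A) = 0 := by rw [hvA i hi, map_zero]
      rw [contractLeft_ι_mul] at h0
      have h0' := congrArg P h0
      simp only [map_sub, map_smul, map_zero, smul_eq_mul] at h0'
      simp only [contractFunctional_apply, LinearMap.comp_apply, LinearMap.neg_apply,
        LinearMap.smul_apply, smul_eq_mul]
      rw [contractLeft_comm, map_neg, hP, ← pfaffianFunctional_ι_mul, ← hP]
      linear_combination h0'
  rw [contractLeft_comm, h2, ← hP, h3, map_sub, LinearMap.sub_apply, hA,
    contractLeft_ι_mul f, contractLeft_ι_mul f, h1, ← hA] at key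
  simp only [map_neg, LinearMap.neg_apply, contractLeft_comm d d', map_sub, map_smul,
    LinearMap.smul_apply, LinearMap.comp_apply,
    smul_eq_mul, mul_zero, sub_zero, wedgeFunctional_apply, mul_smul_comm, hf] at key
  linear_combination -key

end General

/-! ### Pfaffians as values of the functional -/

section Expansion

/-- The permutation `σ` of `Fin (m + 2)` with `σ 0 = 0`, `σ 1 = j + 1`, whose other values are those
of `e` carried to the complement of `{0, j + 1}` by the order isomorphism. -/
def pairPerm {m : ℕ} (j : Fin (m + 1)) (e : Equiv.Perm (Fin m)) : Equiv.Perm (Fin (m + 1 + 1)) :=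
  Equiv.Perm.decomposeFin.symm (0, j.cycleRange.symm * Equiv.Perm.decomposeFin.symm (0, e))

variable {m : ℕ} (j : Fin (m + 1)) (e : Equiv.Perm (Fin m))

@[simp]
lemma pairPerm_zero : pairPerm j e 0 = 0 := by
  simp [pairPerm]

@[simp]
lemma pairPerm_one : pairPerm j e (Fin.succ 0) = j.succ := by
  simp [pairPerm, -Fin.succ_zero_eq_one]

@[simp]
lemma pairPerm_succ_succ (i : Fin m) :
    pairPerm j e i.succ.succ = (j.succAbove (e i)).succ := by
  simp [pairPerm]

lemma sign_pairPerm : Equiv.Perm.sign (pairPerm j e) = (-1) ^ (j : ℕ) * Equiv.Perm.sign e := by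
  simp [pairPerm]

lemma pairPerm_injective :
    Function.Injective fun p : Fin (m + 1) × Equiv.Perm (Fin m) => pairPerm p.1 p.2 := by
  rintro ⟨j, e⟩ ⟨j', e'⟩ h
  have hj : j = j' := by
    have := congrArg (fun σ : Equiv.Perm (Fin (m + 1 + 1)) => σ (Fin.succ 0)) h
    simpa only [pairPerm_one, Fin.succ_inj] using this
  subst hj
  congr 1
  ext1 i
  have := congrArg (fun σ : Equiv.Perm (Fin (m + 1 + 1)) => σ i.succ.succ) h
  simpa using this

lemma exists_pairPerm_eq (σ : Equiv.Perm (Fin (m + 1 + 1))) (h : σ 0 = 0) :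
    ∃ j e, pairPerm j e = σ := by
  obtain ⟨⟨p, τ⟩, rfl⟩ := Equiv.Perm.decomposeFin.symm.surjective σ
  obtain rfl : p = 0 := by simpa using h
  obtain ⟨⟨q, e⟩, he⟩ := Equiv.Perm.decomposeFin.symm.surjective ((τ 0).cycleRange * τ)
  obtain rfl : q = 0 := by
    have := congrArg (fun σ : Equiv.Perm (Fin (m + 1)) => σ 0) he
    simpa using this
  refine ⟨τ 0, e, ?_⟩
  rw [pairPerm, he]
  congr 2
  ext i
  simp

/-- Expansion of the Pfaffian along the first row. -/
theorem pfaffian_succ (N : ℕ) (A : Matrix (Fin (2 * N + 1 + 1)) (Fin (2 * N + 1 + 1)) ℝ) :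
    pfaffian (N + 1) A =
      ∑ j : Fin (2 * N + 1), (-1) ^ (j : ℕ) * A 0 j.succ *
        pfaffian N (A.submatrix (fun i => (j.succAbove i).succ) fun i => (j.succAbove i).succ) := by
  simp only [pfaffian, Finset.mul_sum]
  rw [Finset.sum_sigma']
  symm
  refine Finset.sum_bij (fun p _ => pairPerm p.1 p.2) ?_ ?_ ?_ ?_
  · rintro ⟨j, e⟩ he
    simp only [Finset.mem_sigma, Finset.mem_univ, Finset.mem_filter, true_and] at he ⊢
    constructor
    · intro l
      refine Fin.cases ?_ (fun l => ?_) l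
      · exact (pairPerm_zero j e).trans_lt ((Fin.succ_pos j).trans_eq (pairPerm_one j e).symm)
      · have := he.1 l
        refine (pairPerm_succ_succ (m := 2 * N) j e ⟨2 * l, by omega⟩).trans_lt
          (LT.lt.trans_eq ?_ (pairPerm_succ_succ (m := 2 * N) j e ⟨2 * l + 1, by omega⟩).symm)
        simpa using this
    · intro l k hlk
      induction l using Fin.cases with
      | zero =>
        induction k using Fin.cases with
        | zero => exact absurd hlk (lt_irrefl _)
        | succ k =>
          exact (pairPerm_zero j e).trans_lt
            ((Fin.succ_pos _).trans_eq (pairPerm_succ_succ (m := 2 * N) j e ⟨2 * k, by omega⟩).symm)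
      | succ l =>
        induction k using Fin.cases with
        | zero => exact absurd hlk (by simp)
        | succ k =>
          have := he.2 l k (by simpa using hlk)
          refine (pairPerm_succ_succ (m := 2 * N) j e ⟨2 * l, by omega⟩).trans_lt
            (LT.lt.trans_eq ?_ (pairPerm_succ_succ (m := 2 * N) j e ⟨2 * k, by omega⟩).symm)
          simpa using this
  · rintro ⟨j, e⟩ _ ⟨j', e'⟩ _ h
    have := pairPerm_injective (a₁ := (j, e)) (a₂ := (j', e')) h
    simp only [Prod.mk.injEq] at this
    rw [this.1, this.2]
  · intro σ hσ
    simp only [Finset.mem_univ, Finset.mem_filter, true_and] at hσ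
    -- The least element starts a pair, and this pair is the first one.
    have h0 : σ 0 = 0 := by
      obtain ⟨i, hi⟩ := σ.surjective 0
      rcases Nat.even_or_odd' i with ⟨l, hl | hl⟩
      · have hlN : l < N + 1 := by omega
        rcases Nat.eq_zero_or_pos l with rfl | hpos
        · rwa [show i = 0 from Fin.ext (by simpa using hl)] at hi
        · have := hσ.2 ⟨0, by omega⟩ ⟨l, hlN⟩ hpos
          rw [show (⟨2 * l, by omega⟩ : Fin (2 * N + 1 + 1)) = i from Fin.ext hl.symm] at this
          rw [hi] at this
          exact absurd this (Fin.not_lt_zero _)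
      · have := hσ.1 ⟨l, by omega⟩
        rw [show (⟨2 * l + 1, by omega⟩ : Fin (2 * N + 1 + 1)) = i from Fin.ext hl.symm] at this
        rw [hi] at this
        exact absurd this (Fin.not_lt_zero _)
    obtain ⟨j, e, rfl⟩ := exists_pairPerm_eq σ h0
    refine ⟨⟨j, e⟩, ?_, rfl⟩
    simp only [Finset.mem_sigma, Finset.mem_univ, Finset.mem_filter, true_and]
    constructor
    · intro l
      have := hσ.1 l.succ
      have := (pairPerm_succ_succ (m := 2 * N) j e ⟨2 * l, by omega⟩).symm.trans_lt
          (this.trans_eq (pairPerm_succ_succ (m := 2 * N) j e ⟨2 * l + 1, by omega⟩))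
      simpa using this
    · intro l k hlk
      have := hσ.2 l.succ k.succ (by simpa using hlk)
      have := (pairPerm_succ_succ (m := 2 * N) j e ⟨2 * l, by omega⟩).symm.trans_lt
          (this.trans_eq (pairPerm_succ_succ (m := 2 * N) j e ⟨2 * k, by omega⟩))
      simpa using this
  · rintro ⟨j, e⟩ _
    rw [Fin.prod_univ_succ]
    have h1 : ∀ l : Fin N, A (pairPerm j e ⟨2 * (l.succ : Fin (N + 1)), by simp; omega⟩)
        (pairPerm j e ⟨2 * (l.succ : Fin (N + 1)) + 1,
          by simp only [Fin.val_succ]; omega⟩) =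
        A (j.succAbove (e ⟨2 * l, by omega⟩)).succ (j.succAbove (e ⟨2 * l + 1, by omega⟩)).succ :=
      fun l => congrArg₂ A (pairPerm_succ_succ (m := 2 * N) j e ⟨2 * l, by omega⟩)
        (pairPerm_succ_succ (m := 2 * N) j e ⟨2 * l + 1, by omega⟩)
    have h2 : A (pairPerm j e ⟨2 * ((0 : Fin (N + 1)) : ℕ), by simp⟩)
        (pairPerm j e ⟨2 * ((0 : Fin (N + 1)) : ℕ) + 1, by simp⟩) = A 0 j.succ :=
      congrArg₂ A (pairPerm_zero j e) (pairPerm_one j e)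
    rw [sign_pairPerm, h2, Finset.prod_congr rfl fun l _ => h1 l]
    simp only [Matrix.submatrix_apply]
    push_cast
    ring

lemma pfaffian_zero (A : Matrix (Fin (2 * 0)) (Fin (2 * 0)) ℝ) : pfaffian 0 A = 1 := by
  have : IsEmpty (Fin (2 * 0)) := inferInstanceAs (IsEmpty (Fin 0))
  simp [pfaffian, Finset.filter_true_of_mem]

variable {M : Type*} [AddCommGroup M] [Module ℝ M] {B : LinearMap.BilinForm ℝ M} (hB : B.IsAlt)

theorem pfaffian_eq_pfaffianFunctional (N : ℕ) (v : Fin (2 * N) → M) :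
    pfaffian N (Matrix.of fun i j => B (v i) (v j)) =
      pfaffianFunctional B hB (ιMulti ℝ (2 * N) v) := by
  induction N with
  | zero => rw [pfaffian_zero]; exact ((congrArg _ (ExteriorAlgebra.ιMulti_zero_apply v)).trans
      (pfaffianFunctional_one hB)).symm
  | succ N ih =>
    refine (pfaffian_succ N _).trans ?_
    refine Eq.trans ?_ (congrArg _ (ExteriorAlgebra.ιMulti_succ_apply (n := 2 * N + 1) v)).symm
    rw [pfaffianFunctional_ι_mul, contractLeft_ιMulti, map_sum]
    refine Finset.sum_congr rfl fun j _ => ?_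
    rw [map_smul, smul_eq_mul]
    exact congrArg _ (ih _)

/-- A Pfaffian with an additional first row `d (v 0), d (v 1), …`. -/
theorem pfaffian_eq_pfaffianFunctional_contractLeft (N : ℕ) (v : Fin (2 * N + 1) → M)
    (d : Module.Dual ℝ M) (A : Matrix (Fin (2 * N + 1 + 1)) (Fin (2 * N + 1 + 1)) ℝ)
    (h0 : ∀ j : Fin (2 * N + 1), A 0 j.succ = d (v j))
    (h1 : ∀ i j : Fin (2 * N + 1), A i.succ j.succ = B (v i) (v j)) :
    pfaffian (N + 1) A =
      pfaffianFunctional B hB (contractLeft d (ιMulti ℝ (2 * N + 1) v)) := by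
  rw [pfaffian_succ, contractLeft_ιMulti, map_sum]
  refine Finset.sum_congr rfl fun j _ => ?_
  rw [map_smul, smul_eq_mul, h0, ← pfaffian_eq_pfaffianFunctional]
  congr 2
  ext i k
  simp [h1]

end Expansion

/-! ### Schur's Pfaffian -/

section Schur

lemma prod_erase_eq_prod_succAbove {n : ℕ} (j : Fin (n + 1)) (g : Fin (n + 1) → ℝ) :
    ∏ i ∈ Finset.univ.erase j, g i = ∏ i : Fin n, g (j.succAbove i) := by
  rw [← Finset.compl_singleton, ← Fin.image_succAbove_univ, Finset.prod_image]
  exact fun _ _ _ _ h => Fin.succAbove_right_injective h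

/-- Lagrange interpolation at the nodes `-x j` of `∏ (X + x j) - ∏ (X - x j)`, a polynomial of
degree at most `n`. -/
lemma prod_add_add_prod_sub {n : ℕ} (hn : Even n) (x : Fin (n + 1) → ℝ)
    (hx : Function.Injective x) (y : ℝ) :
    ∏ j, (x j + y) + ∏ j, (x j - y) =
      ∑ j, 2 * x j * ∏ i : Fin n, ((x (j.succAbove i) + x j) / (x (j.succAbove i) - x j) *
        (x (j.succAbove i) + y)) := by
  have hsub : ∀ z : ℝ, ∏ j, (z - x j) = -∏ j, (x j - z) := by
    intro z
    rw [← Finset.prod_congr rfl fun j _ => neg_sub (x j) z, Finset.prod_neg]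
    simp [hn.add_one.neg_one_pow]
  have hv : Set.InjOn (fun j => -x j) (Finset.univ : Finset (Fin (n + 1))) :=
    fun i _ j _ h => hx (neg_injective h)
  set p := Lagrange.nodal Finset.univ (fun j => -x j) - Lagrange.nodal Finset.univ x with hp
  have hdeg : p.degree < (Finset.univ : Finset (Fin (n + 1))).card := by
    rw [← Lagrange.degree_nodal (s := Finset.univ) (v := fun j => -x j)]
    refine Polynomial.degree_sub_lt_left ?_ Lagrange.nodal_ne_zero ?_
    · rw [Lagrange.degree_nodal, Lagrange.degree_nodal]
    · rw [Lagrange.nodal_monic, Lagrange.nodal_monic]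
  have hpe : ∀ z, p.eval z = ∏ j, (x j + z) + ∏ j, (x j - z) := by
    intro z
    rw [hp, Polynomial.eval_sub, Lagrange.eval_nodal, Lagrange.eval_nodal, hsub]
    simp [add_comm]
  rw [← hpe, Lagrange.eq_interpolate hv hdeg, Lagrange.interpolate_apply,
    Polynomial.eval_finsetSum]
  refine Finset.sum_congr rfl fun j _ => ?_
  rw [Polynomial.eval_mul, Polynomial.eval_C, hpe, Lagrange.basis, Polynomial.eval_prod,
    prod_erase_eq_prod_succAbove j, Finset.prod_eq_zero (Finset.mem_univ j) (by ring), zero_add,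
    Fin.prod_univ_succAbove _ j, mul_assoc, ← Finset.prod_mul_distrib]
  congr 1
  · ring
  · refine Finset.prod_congr rfl fun i _ => ?_
    have : x (j.succAbove i) - x j ≠ 0 := sub_ne_zero.mpr fun h => Fin.succAbove_ne j i (hx h)
    simp only [Lagrange.basisDivisor, Polynomial.eval_mul, Polynomial.eval_C, Polynomial.eval_sub,
      Polynomial.eval_X, sub_neg_eq_add]
    rw [show -x j + x (j.succAbove i) = x (j.succAbove i) - x j by ring]
    field_simp
    ring

/-- Partial fraction expansion in `y`. -/
lemma prod_sub_div_add_eq_sum {n : ℕ} (hn : Even n) (x : Fin (n + 1) → ℝ)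
    (hx : Function.Injective x) (hpos : ∀ j, 0 < x j) (y : ℝ) (hy : 0 ≤ y) :
    ∏ j, (x j - y) / (x j + y) =
      ∑ j, (x j - y) / (x j + y) *
        ∏ i : Fin n, (x (j.succAbove i) + x j) / (x (j.succAbove i) - x j) := by
  set c : Fin (n + 1) → ℝ := fun j =>
    ∏ i : Fin n, (x (j.succAbove i) + x j) / (x (j.succAbove i) - x j) with hc
  have hxy : ∀ j, x j + y ≠ 0 := fun j => by have := hpos j; positivity
  have hprod : ∏ j, x j ≠ 0 := Finset.prod_ne_zero_iff.mpr fun j _ => (hpos j).ne'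
  -- At `y = 0` the interpolation formula says that the coefficients add up to `1`.
  have hsum : ∑ j, c j = 1 := by
    have h := prod_add_add_prod_sub hn x hx 0
    simp only [add_zero, sub_zero, Finset.prod_mul_distrib] at h
    have h' : ∀ j, 2 * x j * (c j * ∏ i : Fin n, x (j.succAbove i)) = 2 * c j * ∏ j, x j := by
      intro j; rw [Fin.prod_univ_succAbove _ j]; ring
    rw [Finset.sum_congr rfl fun j _ => h' j, ← Finset.sum_mul, ← Finset.mul_sum] at h
    have := mul_right_cancel₀ hprod ((two_mul (∏ j, x j)).trans h)
    linarith
  have h := prod_add_add_prod_sub hn x hx y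
  simp only [Finset.prod_mul_distrib] at h
  rw [Finset.prod_div_distrib, div_eq_iff (Finset.prod_ne_zero_iff.mpr fun j _ => hxy j),
    Finset.sum_mul]
  have h1 : ∀ j, (x j - y) / (x j + y) * c j * ∏ j, (x j + y) =
      2 * x j * (c j * ∏ i : Fin n, (x (j.succAbove i) + y)) - c j * ∏ j, (x j + y) := by
    intro j
    rw [Fin.prod_univ_succAbove _ j]
    have := hxy j
    field_simp
    ring
  rw [Finset.sum_congr rfl fun j _ => h1 j, Finset.sum_sub_distrib, ← h, ← Finset.sum_mul, hsum]
  ring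

/-- The product `∏_{i<j} (x j - x i) / (x j + x i)`. -/
def schurProd {k : ℕ} (x : Fin k → ℝ) : ℝ :=
  ∏ i, ∏ j ∈ Finset.Ioi i, (x j - x i) / (x j + x i)

lemma schurProd_succ {k : ℕ} (x : Fin (k + 1) → ℝ) :
    schurProd x = (∏ j : Fin k, (x j.succ - x 0) / (x j.succ + x 0)) *
      schurProd fun i => x i.succ := by
  rw [schurProd, Fin.prod_univ_succ, Fin.prod_Ioi_zero]
  simp only [schurProd, Fin.prod_Ioi_succ]

/-- The factors of `schurProd x` that contain `x j`. -/
lemma schurProd_eq_mul_succAbove {k : ℕ} (x : Fin (k + 1) → ℝ) (j : Fin (k + 1)) :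
    schurProd x = (-1) ^ (j : ℕ) *
      (∏ i : Fin k, (x (j.succAbove i) - x j) / (x (j.succAbove i) + x j)) *
      schurProd fun i => x (j.succAbove i) := by
  induction k with
  | zero => obtain rfl : j = 0 := Fin.fin_one_eq_zero j; simp [schurProd]
  | succ k ih =>
    rw [schurProd_succ]
    induction j using Fin.cases with
    | zero => simp
    | succ j =>
      rw [ih (fun i => x i.succ) j, Fin.prod_univ_succAbove _ j,
        schurProd_succ fun i => x (j.succ.succAbove i), Fin.prod_univ_succ]
      simp only [Fin.succ_succAbove_zero, Fin.succ_succAbove_succ, Fin.val_succ, pow_succ]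
      rw [show (x j.succ - x 0) / (x j.succ + x 0) = -((x 0 - x j.succ) / (x 0 + x j.succ)) by
        rw [← neg_div, neg_sub, add_comm (x 0)]]
      ring

/-- Row expansion satisfied by `schurProd`; `y` plays the role of an additional first variable. -/
lemma prod_mul_schurProd_eq_sum {n : ℕ} (hn : Even n) (x : Fin (n + 1) → ℝ)
    (hx : Function.Injective x) (hpos : ∀ j, 0 < x j) (y : ℝ) (hy : 0 ≤ y) :
    (∏ j, (x j - y) / (x j + y)) * schurProd x =
      ∑ j : Fin (n + 1), (-1) ^ (j : ℕ) * ((x j - y) / (x j + y)) *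
        schurProd fun i => x (j.succAbove i) := by
  rw [prod_sub_div_add_eq_sum hn x hx hpos y hy, Finset.sum_mul]
  refine Finset.sum_congr rfl fun j _ => ?_
  have h1 : (∏ i : Fin n, (x (j.succAbove i) + x j) / (x (j.succAbove i) - x j)) *
      (∏ i : Fin n, (x (j.succAbove i) - x j) / (x (j.succAbove i) + x j)) = 1 := by
    rw [← Finset.prod_mul_distrib]
    refine Finset.prod_eq_one fun i _ => ?_
    have h : x (j.succAbove i) - x j ≠ 0 := sub_ne_zero.mpr fun h => Fin.succAbove_ne j i (hx h)
    have h' : x (j.succAbove i) + x j ≠ 0 := (add_pos (hpos _) (hpos _)).ne'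
    field_simp
  rw [schurProd_eq_mul_succAbove x j]
  linear_combination ((x j - y) / (x j + y) * (-1) ^ (j : ℕ) *
    schurProd fun i => x (j.succAbove i)) * h1

variable {M : Type*} [AddCommGroup M] [Module ℝ M] {B : LinearMap.BilinForm ℝ M} (hB : B.IsAlt)

/-- Schur's Pfaffian. -/
theorem pfaffianFunctional_eq_schurProd (N : ℕ) (v : Fin (2 * N) → M) (x : Fin (2 * N) → ℝ)
    (hx : Function.Injective x) (hpos : ∀ j, 0 < x j)
    (h : ∀ i j, B (v i) (v j) = (x j - x i) / (x j + x i)) :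
    pfaffianFunctional B hB (ιMulti ℝ (2 * N) v) = schurProd x := by
  induction N with
  | zero =>
    refine ((congrArg _ (ExteriorAlgebra.ιMulti_zero_apply v)).trans
      (pfaffianFunctional_one hB)).trans (Finset.prod_of_isEmpty (ι := Fin 0) _).symm
  | succ N ih =>
    refine (congrArg _ (ExteriorAlgebra.ιMulti_succ_apply (n := 2 * N + 1) v)).trans ?_
    refine Eq.trans ?_ (schurProd_succ (k := 2 * N + 1) x).symm
    rw [pfaffianFunctional_ι_mul, contractLeft_ιMulti, map_sum,
      prod_mul_schurProd_eq_sum (even_two_mul N) (fun i : Fin (2 * N + 1) => x i.succ)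
        (fun i j hij => Fin.succ_injective _ (hx hij)) (fun j => hpos _) (x 0) (hpos 0).le]
    refine Finset.sum_congr rfl fun j _ => ?_
    rw [map_smul, smul_eq_mul]
    refine congrArg₂ _ (congrArg _ (h 0 j.succ)) (ih _ _ ?_ ?_ ?_)
    · exact fun a b hab => Fin.succAbove_right_injective (Fin.succ_injective _ (hx hab))
    · exact fun i => hpos _
    · exact fun i k => h _ _

/-- Schur's Pfaffian with an odd number of variables, bordered by a row of ones. This is the limit
of the even case in which the first variable is `0`. -/
theorem pfaffianFunctional_contractLeft_eq_schurProd (N : ℕ) (v : Fin (2 * N + 1) → M)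
    (x : Fin (2 * N + 1) → ℝ) (hx : Function.Injective x) (hpos : ∀ j, 0 < x j)
    (h : ∀ i j, B (v i) (v j) = (x j - x i) / (x j + x i)) (d : Module.Dual ℝ M)
    (hd : ∀ i, d (v i) = 1) :
    pfaffianFunctional B hB (contractLeft d (ιMulti ℝ (2 * N + 1) v)) = schurProd x := by
  have key := prod_mul_schurProd_eq_sum (even_two_mul N) x hx hpos 0 le_rfl
  simp only [sub_zero, add_zero, div_self (hpos _).ne', Finset.prod_const_one, one_mul,
    mul_one] at key
  rw [key, contractLeft_ιMulti, map_sum]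
  refine Finset.sum_congr rfl fun j _ => ?_
  rw [map_smul, smul_eq_mul, hd, mul_one,
    pfaffianFunctional_eq_schurProd hB N _ (fun i => x (j.succAbove i))
      (fun a b hab => Fin.succAbove_right_injective (hx hab)) (fun i => hpos _) fun i k => h _ _]

end Schur

/-! ### The double integrals -/

section Integrals

open MeasureTheory

lemma measurableSet_region (t : ℝ) : MeasurableSet (region t) :=
  (measurableSet_lt measurable_fst measurable_snd).inter
    (measurableSet_lt measurable_snd measurable_const)

lemma integrableOn_exp_mul_exp {a c : ℝ} (ha : 0 < a) (hc : 0 < c) (t : ℝ) :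
    IntegrableOn (fun p : ℝ × ℝ => Real.exp (a * p.1) * Real.exp (c * p.2)) (region t) := by
  have h : IntegrableOn (fun p : ℝ × ℝ => Real.exp (a * p.1) * Real.exp (c * p.2))
      (Set.Iic t ×ˢ Set.Iic t) := by
    rw [IntegrableOn, Measure.volume_eq_prod, ← Measure.prod_restrict]
    exact (integrableOn_exp_mul_Iic ha t).mul_prod (integrableOn_exp_mul_Iic hc t)
  refine h.mono_set fun p hp => ?_
  exact ⟨(hp.1.trans hp.2).le, hp.2.le⟩

lemma integral_exp_mul_exp {a c : ℝ} (ha : 0 < a) (hc : 0 < c) (t : ℝ) :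
    ∫ p in region t, Real.exp (a * p.1) * Real.exp (c * p.2) =
      Real.exp ((a + c) * t) / (a * (a + c)) := by
  have hint := integrableOn_exp_mul_exp ha hc t
  rw [← integrable_indicator_iff (measurableSet_region t), Measure.volume_eq_prod] at hint
  rw [← integral_indicator (measurableSet_region t), Measure.volume_eq_prod,
    integral_prod_symm _ hint]
  have h1 : ∀ y : ℝ, ∫ x : ℝ, (region t).indicator
      (fun p : ℝ × ℝ => Real.exp (a * p.1) * Real.exp (c * p.2)) (x, y) =
      (Set.Iio t).indicator (fun y => Real.exp ((a + c) * y) / a) y := by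
    intro y
    by_cases hy : y < t
    · have h2 : (fun x => (region t).indicator
          (fun p : ℝ × ℝ => Real.exp (a * p.1) * Real.exp (c * p.2)) (x, y)) =
          (Set.Iio y).indicator fun x => Real.exp (a * x) * Real.exp (c * y) := by
        ext x
        simp [Set.indicator, region, hy]
      rw [h2, integral_indicator measurableSet_Iio, integral_mul_const,
        ← integral_Iic_eq_integral_Iio, integral_exp_mul_Iic ha,
        Set.indicator_of_mem (Set.mem_Iio.mpr hy), add_mul, Real.exp_add]
      ring
    · have h2 : (fun x => (region t).indicator
          (fun p : ℝ × ℝ => Real.exp (a * p.1) * Real.exp (c * p.2)) (x, y)) = fun _ => 0 := by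
        ext x
        simp [Set.indicator, region, hy]
      rw [h2, Set.indicator_of_notMem (by simpa using hy)]
      simp
  simp_rw [h1]
  rw [integral_indicator measurableSet_Iio, integral_div, ← integral_Iic_eq_integral_Iio,
    integral_exp_mul_Iic (add_pos ha hc), div_div, mul_comm a]

variable {n : ℕ} (ζ b₀ : Fin n → ℝ) (α : ℝ)

lemma integrand_eq_sum (i j : ℕ) : integrand ζ b₀ α i j = fun p =>
    ∑ r, ∑ s, (ζ r ^ (i + 1) * ζ s ^ (j + 1) * (b₀ r * b₀ s)) *
      (Real.exp (ζ r * p.1) * Real.exp ((ζ s + α) * p.2) -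
        Real.exp (ζ s * p.1) * Real.exp ((ζ r + α) * p.2)) := by
  funext p
  simp only [integrand, f, b, Finset.sum_mul_sum]
  rw [← Finset.sum_sub_distrib, Finset.mul_sum]
  refine Finset.sum_congr rfl fun r _ => ?_
  rw [← Finset.sum_sub_distrib, Finset.mul_sum]
  refine Finset.sum_congr rfl fun s _ => ?_
  simp only [add_mul, Real.exp_add]
  ring

variable {ζ α} (hζ : ∀ j, 0 < ζ j) (hα : 0 ≤ α)
include hζ hα

lemma integrableOn_term (t : ℝ) (r s : Fin n) (C : ℝ) :
    IntegrableOn (fun p : ℝ × ℝ => C *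
      (Real.exp (ζ r * p.1) * Real.exp ((ζ s + α) * p.2) -
        Real.exp (ζ s * p.1) * Real.exp ((ζ r + α) * p.2))) (region t) :=
  ((integrableOn_exp_mul_exp (hζ r) (add_pos_of_pos_of_nonneg (hζ s) hα) t).sub
    (integrableOn_exp_mul_exp (hζ s) (add_pos_of_pos_of_nonneg (hζ r) hα) t)).const_mul C

theorem integrableOn_integrand (i j : ℕ) (t : ℝ) :
    IntegrableOn (integrand ζ b₀ α i j) (region t) := by
  rw [integrand_eq_sum]
  exact integrable_finsetSum _ fun r _ => integrable_finsetSum _ fun s _ =>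
    integrableOn_term hζ hα t r s _

theorem entry_some_some (i j : ℕ) (t : ℝ) :
    entry ζ b₀ α t (some i) (some j) =
      ∑ r, ∑ s, (ζ r ^ i * b ζ b₀ r t) * (ζ s ^ j * b ζ b₀ s t) *
        ((ζ s - ζ r) / (ζ s + ζ r + α)) := by
  rw [entry, integrand_eq_sum, integral_finsetSum _ fun r _ => integrable_finsetSum _ fun s _ =>
    integrableOn_term hζ hα t r s _, Finset.mul_sum]
  refine Finset.sum_congr rfl fun r _ => ?_
  rw [integral_finsetSum _ fun s _ => integrableOn_term hζ hα t r s _, Finset.mul_sum]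
  refine Finset.sum_congr rfl fun s _ => ?_
  have hr := hζ r
  have hs := hζ s
  have hrα : 0 < ζ r + α := by positivity
  have hsα : 0 < ζ s + α := by positivity
  have hd : ζ s + ζ r + α ≠ 0 := by positivity
  rw [integral_const_mul, integral_sub (integrableOn_exp_mul_exp hr hsα t)
    (integrableOn_exp_mul_exp hs hrα t), integral_exp_mul_exp hr hsα, integral_exp_mul_exp hs hrα,
    show ζ r + (ζ s + α) = ζ s + ζ r + α by ring, show ζ s + (ζ r + α) = ζ s + ζ r + α by ring]
  simp only [b]
  have he : Real.exp (-(α * t)) * Real.exp ((ζ s + ζ r + α) * t) =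
      Real.exp (ζ r * t) * Real.exp (ζ s * t) := by
    rw [← Real.exp_add, ← Real.exp_add]; congr 1; ring
  have h2 : Real.exp ((ζ s + ζ r + α) * t) / (ζ r * (ζ s + ζ r + α)) -
      Real.exp ((ζ s + ζ r + α) * t) / (ζ s * (ζ s + ζ r + α)) =
      Real.exp ((ζ s + ζ r + α) * t) * ((ζ s - ζ r) / (ζ s + ζ r + α)) / (ζ r * ζ s) := by
    field_simp
  rw [h2, pow_succ, pow_succ]
  have h3 : ζ r * ζ s * (1 / (ζ r * ζ s)) = 1 := by field_simp
  linear_combination (ζ r ^ i * ζ s ^ j * b₀ r * b₀ s * ((ζ s - ζ r) / (ζ s + ζ r + α))) *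
    (Real.exp (-(α * t)) * Real.exp ((ζ s + ζ r + α) * t) * h3 + he)

end Integrals

/-! ### The form of the lattice and the time derivative -/

section Lattice

lemma sum_sum_eq_zero_of_antisymm {κ : Type*} [Fintype κ] (g : κ → κ → ℝ)
    (h : ∀ r s, g r s + g s r = 0) : ∑ r, ∑ s, g r s = 0 := by
  have h1 : ∑ r, ∑ s, g r s + ∑ r, ∑ s, g r s = 0 := by
    nth_rw 2 [Finset.sum_comm]
    simp [← Finset.sum_add_distrib, h]
  linarith

variable {n : ℕ}

/-- The alternating form on `ℝⁿ` with matrix `(ζ s - ζ r) / (ζ s + ζ r + α)`. -/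
def cauchyForm (ζ : Fin n → ℝ) (α : ℝ) : LinearMap.BilinForm ℝ (Fin n → ℝ) :=
  Matrix.toBilin' (Matrix.of fun r s => (ζ s - ζ r) / (ζ s + ζ r + α))

lemma cauchyForm_apply (ζ : Fin n → ℝ) (α : ℝ) (x y : Fin n → ℝ) :
    cauchyForm ζ α x y = ∑ r, ∑ s, x r * y s * ((ζ s - ζ r) / (ζ s + ζ r + α)) := by
  rw [cauchyForm, Matrix.toBilin'_apply]
  simp only [Matrix.of_apply]
  exact Finset.sum_congr rfl fun r _ => Finset.sum_congr rfl fun s _ => by ring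

lemma cauchyForm_isAlt (ζ : Fin n → ℝ) (α : ℝ) : (cauchyForm ζ α).IsAlt := fun x => by
  rw [cauchyForm_apply]
  refine sum_sum_eq_zero_of_antisymm _ fun r s => ?_
  rw [add_comm (ζ s) (ζ r), ← neg_sub (ζ r) (ζ s), neg_div]
  ring

lemma cauchyForm_single_single (ζ : Fin n → ℝ) (α : ℝ) (r s : Fin n) :
    cauchyForm ζ α (Pi.single r 1) (Pi.single s 1) = (ζ s - ζ r) / (ζ s + ζ r + α) := by
  simp [cauchyForm]

lemma cauchyForm_single (ζ : Fin n → ℝ) (α : ℝ) (r : Fin n) :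
    cauchyForm ζ α (Pi.single r 1) =
      ∑ s, ((ζ s - ζ r) / (ζ s + ζ r + α)) • LinearMap.proj s := by
  refine LinearMap.pi_ext' fun s => LinearMap.ext_ring ?_
  simp [cauchyForm_single_single, Pi.single_apply]

/-- The functional `x ↦ ∑ ζ r ^ i * x r`. -/
def powerFunctional (ζ : Fin n → ℝ) (i : ℕ) : Module.Dual ℝ (Fin n → ℝ) :=
  ∑ r, ζ r ^ i • LinearMap.proj r

lemma powerFunctional_apply (ζ : Fin n → ℝ) (i : ℕ) (x : Fin n → ℝ) :
    powerFunctional ζ i x = ∑ r, ζ r ^ i * x r := by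
  simp [powerFunctional, LinearMap.sum_apply]

lemma powerFunctional_single (ζ : Fin n → ℝ) (i : ℕ) (r : Fin n) :
    powerFunctional ζ i (Pi.single r 1) = ζ r ^ i := by
  simp [powerFunctional_apply, Pi.single_apply]

/-- The derivation of the exterior algebra of `ℝⁿ` that multiplies the `r`-th basis vector
by `c r`. -/
def weightDerivation (c : Fin n → ℝ) :
    ExteriorAlgebra ℝ (Fin n → ℝ) →ₗ[ℝ] ExteriorAlgebra ℝ (Fin n → ℝ) :=
  ∑ r, c r • (LinearMap.mulLeft ℝ (ι ℝ (Pi.single r (1 : ℝ))) ∘ₗ contractLeft (LinearMap.proj r))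

lemma weightDerivation_apply (c : Fin n → ℝ) (x : ExteriorAlgebra ℝ (Fin n → ℝ)) :
    weightDerivation c x =
      ∑ r, c r • (ι ℝ (Pi.single r (1 : ℝ)) * contractLeft (LinearMap.proj r) x) := by
  simp [weightDerivation, LinearMap.sum_apply]

lemma ι_eq_sum (x : Fin n → ℝ) : ι ℝ x = ∑ r, x r • ι ℝ (Pi.single r (1 : ℝ)) := by
  conv_lhs => rw [pi_eq_sum_univ' x]
  rw [map_sum]
  exact Finset.sum_congr rfl fun r _ => by
    rw [map_smul]

lemma weightDerivation_one (c : Fin n → ℝ) : weightDerivation c 1 = 0 := by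
  simp [weightDerivation_apply]

lemma weightDerivation_ι_mul (c x : Fin n → ℝ) (y : ExteriorAlgebra ℝ (Fin n → ℝ)) :
    weightDerivation c (ι ℝ x * y) = ι ℝ (c * x) * y + ι ℝ x * weightDerivation c y := by
  rw [weightDerivation_apply, weightDerivation_apply, ι_eq_sum (c * x), Finset.sum_mul,
    Finset.mul_sum, ← Finset.sum_add_distrib]
  refine Finset.sum_congr rfl fun r _ => ?_
  rw [contractLeft_ι_mul, mul_sub, ι_mul_ι_comm]
  simp [mul_smul]

lemma contractLeft_weightDerivation (c : Fin n → ℝ) (d d' : Module.Dual ℝ (Fin n → ℝ))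
    (h : ∀ r, d' (Pi.single r 1) = c r * d (Pi.single r 1))
    (x : ExteriorAlgebra ℝ (Fin n → ℝ)) :
    contractLeft d (weightDerivation c x) =
      contractLeft d' x + weightDerivation c (contractLeft d x) := by
  have hd' : d' = ∑ r, (c r * d (Pi.single r 1)) • LinearMap.proj r := by
    refine LinearMap.pi_ext' fun s => LinearMap.ext_ring ?_
    simp [h, Pi.single_apply]
  rw [weightDerivation_apply, weightDerivation_apply, hd', map_sum, map_sum,
    LinearMap.sum_apply, ← Finset.sum_add_distrib]
  refine Finset.sum_congr rfl fun r _ => ?_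
  rw [map_smul, contractLeft_ι_mul, contractLeft_comm d]
  simp [mul_smul]

lemma pfaffianFunctional_weightDerivation (ζ : Fin n → ℝ) (α : ℝ) (c : Fin n → ℝ)
    (x : ExteriorAlgebra ℝ (Fin n → ℝ)) :
    pfaffianFunctional _ (cauchyForm_isAlt ζ α) (weightDerivation c x) =
      ∑ r, ∑ s, c r * ((ζ s - ζ r) / (ζ s + ζ r + α)) *
        pfaffianFunctional _ (cauchyForm_isAlt ζ α)
          (contractLeft (LinearMap.proj s) (contractLeft (LinearMap.proj r) x)) := by
  rw [weightDerivation_apply, map_sum]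
  refine Finset.sum_congr rfl fun r _ => ?_
  rw [map_smul, pfaffianFunctional_ι_mul, cauchyForm_single, map_sum, LinearMap.sum_apply, map_sum,
    smul_eq_mul, Finset.mul_sum]
  refine Finset.sum_congr rfl fun s _ => ?_
  rw [map_smul, LinearMap.smul_apply, map_smul, smul_eq_mul]
  ring

/-- The two expressions for the time derivative of a Pfaffian: the derivation `ζ` raises the indices
one at a time (see `hasDerivAt_descWedge`), while the factor `ζ s + ζ r + α` cancels the
denominators of the form up to a multiple of the degree, which `weightDerivation 1` measures. -/
theorem pfaffianFunctional_weightDerivation_eq {ζ : Fin n → ℝ} (hζ : ∀ j, 0 < ζ j) {α : ℝ}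
    (hα : 0 ≤ α) (x : ExteriorAlgebra ℝ (Fin n → ℝ)) :
    pfaffianFunctional _ (cauchyForm_isAlt ζ α) (weightDerivation ζ x) =
      -(α / 2) * pfaffianFunctional _ (cauchyForm_isAlt ζ α) (weightDerivation 1 x) +
        pfaffianFunctional _ (cauchyForm_isAlt ζ α)
          (contractLeft (powerFunctional ζ 1) (contractLeft (powerFunctional ζ 0) x)) := by
  set P := pfaffianFunctional _ (cauchyForm_isAlt ζ α) with hP
  have h1 : P (contractLeft (powerFunctional ζ 1) (contractLeft (powerFunctional ζ 0) x)) =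
      ∑ r, ∑ s, ζ s * P (contractLeft (LinearMap.proj s) (contractLeft (LinearMap.proj r) x)) := by
    simp only [powerFunctional, map_sum, LinearMap.sum_apply, map_smul, LinearMap.smul_apply,
      pow_zero, pow_one, one_smul, smul_eq_mul]
  rw [h1, hP, pfaffianFunctional_weightDerivation, pfaffianFunctional_weightDerivation, ← hP,
    ← sub_eq_zero, Finset.mul_sum, ← Finset.sum_add_distrib, ← Finset.sum_sub_distrib]
  simp only [Finset.mul_sum, ← Finset.sum_add_distrib, ← Finset.sum_sub_distrib]
  refine sum_sum_eq_zero_of_antisymm _ fun r s => ?_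
  have hc := contractLeft_comm (Q := 0) (LinearMap.proj r : Module.Dual ℝ (Fin n → ℝ))
    (LinearMap.proj s) x
  rw [hc, map_neg]
  have hd : ζ s + ζ r + α ≠ 0 := by
    have := hζ s; have := hζ r; positivity
  rw [add_comm (ζ r) (ζ s)]
  field_simp
  simp only [Pi.one_apply]
  ring

variable (ζ b₀ : Fin n → ℝ)

/-- The vector `(ζ_r ^ i b_r(t))_r`; the entries `(d₀, i)` and `(i, j)` are values of
`powerFunctional` and `cauchyForm` at these vectors. -/
def momentVec (t : ℝ) (i : ℕ) : Fin n → ℝ := fun r => ζ r ^ i * b ζ b₀ r t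

lemma mul_momentVec (t : ℝ) (i : ℕ) : ζ * momentVec ζ b₀ t i = momentVec ζ b₀ t (i + 1) := by
  ext r; simp [momentVec, pow_succ]; ring

lemma weightDerivation_descWedge (t : ℝ) (k : ℕ) :
    weightDerivation ζ (descWedge (momentVec ζ b₀ t) (k + 1)) =
      ι ℝ (momentVec ζ b₀ t (k + 1)) * descWedge (momentVec ζ b₀ t) k := by
  induction k with
  | zero =>
    change weightDerivation ζ (ι ℝ (momentVec ζ b₀ t 0) * 1) = ι ℝ (momentVec ζ b₀ t 1) * 1
    rw [weightDerivation_ι_mul, mul_momentVec, weightDerivation_one, mul_zero, add_zero]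
  | succ k ih =>
    rw [descWedge, weightDerivation_ι_mul, ih, mul_momentVec, ← mul_assoc (ι ℝ _) (ι ℝ _),
      ExteriorAlgebra.ι_sq_zero, zero_mul, add_zero]

lemma weightDerivation_one_descWedge (v : ℕ → Fin n → ℝ) (k : ℕ) :
    weightDerivation 1 (descWedge v k) = (k : ℝ) • descWedge v k := by
  induction k with
  | zero => simp [descWedge, weightDerivation_one]
  | succ k ih =>
    rw [descWedge, weightDerivation_ι_mul, ih, one_mul]
    push_cast
    rw [add_smul, one_smul, add_comm, mul_smul_comm]

/-- Differentiation in time acts on `descWedge (momentVec ζ b₀ t) k` as `weightDerivation ζ`. -/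
lemma hasDerivAt_descWedge (k : ℕ) (L : ExteriorAlgebra ℝ (Fin n → ℝ) →ₗ[ℝ] ℝ) (t : ℝ) :
    HasDerivAt (fun t => L (descWedge (momentVec ζ b₀ t) k))
      (L (weightDerivation ζ (descWedge (momentVec ζ b₀ t) k))) t := by
  induction k generalizing L with
  | zero => simpa [descWedge, weightDerivation_one] using hasDerivAt_const t _
  | succ k ih =>
    have hb : ∀ r, HasDerivAt (fun t => momentVec ζ b₀ t k r) (momentVec ζ b₀ t (k + 1) r) t := by
      intro r
      have h : HasDerivAt (fun t => Real.exp (ζ r * t)) (Real.exp (ζ r * t) * (ζ r * 1)) t :=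
        ((hasDerivAt_id t).const_mul (ζ r)).exp
      refine ((h.const_mul (b₀ r)).const_mul (ζ r ^ k)).congr_deriv ?_
      simp only [momentVec, b, pow_succ]
      ring
    have hL : ∀ (x : Fin n → ℝ) (y : ExteriorAlgebra ℝ (Fin n → ℝ)),
        L (ι ℝ x * y) = ∑ r, x r * (L ∘ₗ LinearMap.mulLeft ℝ (ι ℝ (Pi.single r (1 : ℝ)))) y := by
      intro x y
      rw [ι_eq_sum, Finset.sum_mul, map_sum]
      simp
    simp only [descWedge, weightDerivation_ι_mul, mul_momentVec, map_add, hL]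
    rw [← Finset.sum_add_distrib]
    exact HasDerivAt.fun_sum fun r _ => (hb r).mul (ih _)

lemma contDiff_descWedge {m : WithTop ℕ∞} (k : ℕ) (L : ExteriorAlgebra ℝ (Fin n → ℝ) →ₗ[ℝ] ℝ) :
    ContDiff ℝ m (fun t => L (descWedge (momentVec ζ b₀ t) k)) := by
  induction k generalizing L with
  | zero => simpa [descWedge] using contDiff_const
  | succ k ih =>
    have hL : ∀ (x : Fin n → ℝ) (y : ExteriorAlgebra ℝ (Fin n → ℝ)),
        L (ι ℝ x * y) = ∑ r, x r * (L ∘ₗ LinearMap.mulLeft ℝ (ι ℝ (Pi.single r (1 : ℝ)))) y := by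
      intro x y
      rw [ι_eq_sum, Finset.sum_mul, map_sum]
      simp
    simp only [descWedge, hL]
    refine ContDiff.sum fun r _ => ContDiff.mul ?_ (ih _)
    unfold momentVec b
    fun_prop

lemma descWedge_eq_zero (v : ℕ → Fin n → ℝ) : descWedge (R := ℝ) v (n + 1) = 0 := by
  have h : ιMulti ℝ (n + 1) (fun i : Fin (n + 1) => v i) = 0 := by
    refine AlternatingMap.map_linearDependent _ _ fun h => ?_
    simpa using h.fintype_card_le_finrank
  rw [ιMulti_eq_reversalSign_smul_descWedge] at h
  have h2 := congrArg (reversalSign ℝ (n + 1) • ·) h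
  simpa [smul_smul, reversalSign_sq] using h2

/-- The functional whose value at `v₀ ∧ ⋯ ∧ v_{k-1}` is `τ̃_k`: the Pfaffian `(0, …, k-1)` for even
`k` and `(d₀, 0, …, k-1)` for odd `k`. -/
def tauFunctional (α : ℝ) (k : ℕ) : ExteriorAlgebra ℝ (Fin n → ℝ) →ₗ[ℝ] ℝ :=
  if Even k then pfaffianFunctional _ (cauchyForm_isAlt ζ α)
  else pfaffianFunctional _ (cauchyForm_isAlt ζ α) ∘ₗ contractLeft (powerFunctional ζ 0)

variable {ζ} (hζ : ∀ j, 0 < ζ j) {α : ℝ} (hα : 0 ≤ α)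

section
include hζ hα

lemma entry_some_some_eq_cauchyForm (i j : ℕ) (t : ℝ) :
    entry ζ b₀ α t (some i) (some j) =
      cauchyForm ζ α (momentVec ζ b₀ t i) (momentVec ζ b₀ t j) := by
  rw [entry_some_some b₀ hζ hα, cauchyForm_apply]
  rfl

theorem tauTilde_eq_ιMulti (k : ℕ) (t : ℝ) :
    tauTilde ζ b₀ α k t =
      tauFunctional ζ α k (ιMulti ℝ k fun i : Fin k => momentVec ζ b₀ t i) := by
  rw [tauTilde, if_neg (by omega)]
  rcases Nat.even_or_odd' k with ⟨m, rfl | rfl⟩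
  · rw [if_pos (by simp), tauFunctional, if_pos (by simp),
      show ((2 * m : ℕ) / 2 : ℤ).toNat = m by omega, symbolPfaffian,
      ← pfaffian_eq_pfaffianFunctional]
    simp only [evenSymbols, entry_some_some_eq_cauchyForm b₀ hζ hα]
  · rw [if_neg (by simp [parity_simps]), tauFunctional, if_neg (by simp [parity_simps]),
      show (((2 * m + 1 : ℕ) + 1) / 2 : ℤ).toNat = m + 1 by omega, symbolPfaffian,
      LinearMap.comp_apply]
    refine pfaffian_eq_pfaffianFunctional_contractLeft _ _ _ _ _ (fun j => ?_) fun i j => ?_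
    · simp [oddSymbols, entry, powerFunctional_apply, momentVec, f]
    · exact entry_some_some_eq_cauchyForm b₀ hζ hα _ _ _

theorem tauTilde_eq_descWedge (k : ℕ) :
    tauTilde ζ b₀ α k = fun t =>
      (reversalSign ℝ k • tauFunctional ζ α k) (descWedge (momentVec ζ b₀ t) k) := by
  funext t
  rw [tauTilde_eq_ιMulti b₀ hζ hα, ιMulti_eq_reversalSign_smul_descWedge, map_smul,
    LinearMap.smul_apply]

lemma deriv_tauTilde (k : ℕ) :
    deriv (tauTilde ζ b₀ α k) = fun t => (reversalSign ℝ k • tauFunctional ζ α k)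
      (weightDerivation ζ (descWedge (momentVec ζ b₀ t) k)) := by
  rw [tauTilde_eq_descWedge b₀ hζ hα]
  exact funext fun t => (hasDerivAt_descWedge ζ b₀ k _ t).deriv

lemma deriv_deriv_tauTilde (k : ℕ) :
    deriv (deriv (tauTilde ζ b₀ α k)) = fun t => (reversalSign ℝ k • tauFunctional ζ α k)
      (weightDerivation ζ (weightDerivation ζ (descWedge (momentVec ζ b₀ t) k))) := by
  rw [deriv_tauTilde b₀ hζ hα]
  exact funext fun t => (hasDerivAt_descWedge ζ b₀ k
    ((reversalSign ℝ k • tauFunctional ζ α k) ∘ₗ weightDerivation ζ) t).deriv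

/-- `pfaffianFunctional_weightDerivation_eq` with a row `d₀` added. -/
lemma pfaffianFunctional_contractLeft_weightDerivation (x : ExteriorAlgebra ℝ (Fin n → ℝ)) :
    pfaffianFunctional _ (cauchyForm_isAlt ζ α)
        (contractLeft (powerFunctional ζ 0) (weightDerivation ζ x)) =
      pfaffianFunctional _ (cauchyForm_isAlt ζ α) (contractLeft (powerFunctional ζ 1) x) -
        α / 2 * (pfaffianFunctional _ (cauchyForm_isAlt ζ α)
            (contractLeft (powerFunctional ζ 0) (weightDerivation 1 x)) -
          pfaffianFunctional _ (cauchyForm_isAlt ζ α) (contractLeft (powerFunctional ζ 0) x)) := by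
  rw [contractLeft_weightDerivation ζ (powerFunctional ζ 0) (powerFunctional ζ 1)
      (fun r => by simp [powerFunctional_single]),
    contractLeft_weightDerivation 1 (powerFunctional ζ 0) (powerFunctional ζ 0)
      (fun r => by simp [powerFunctional_single]), map_add, map_add,
    pfaffianFunctional_weightDerivation_eq hζ hα,
    CliffordAlgebra.contractLeft_contractLeft, map_zero, map_zero]
  ring

theorem tauTilde_equation (k : ℕ) (t : ℝ) :
    deriv (deriv (tauTilde ζ b₀ α (k + 1 : ℕ))) t * tauTilde ζ b₀ α (k + 1 : ℕ) t -
        deriv (tauTilde ζ b₀ α (k + 1 : ℕ)) t ^ 2 =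
      deriv (tauTilde ζ b₀ α (k + 2 : ℕ)) t * tauTilde ζ b₀ α k t -
        tauTilde ζ b₀ α (k + 2 : ℕ) t * deriv (tauTilde ζ b₀ α k) t +
        α * tauTilde ζ b₀ α (k + 2 : ℕ) t * tauTilde ζ b₀ α k t := by
  rw [deriv_deriv_tauTilde b₀ hζ hα]
  simp only [deriv_tauTilde b₀ hζ hα]
  simp only [tauTilde_eq_descWedge b₀ hζ hα, LinearMap.smul_apply, smul_eq_mul,
    reversalSign_add_two]
  have hs0 := reversalSign_sq (R := ℝ) k
  have hs1 := reversalSign_sq (R := ℝ) (k + 1)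
  -- The bilinear equation after cancelling the squares of the signs.
  suffices h : tauFunctional ζ α (k + 1) (weightDerivation ζ (weightDerivation ζ
        (descWedge (momentVec ζ b₀ t) (k + 1)))) *
        tauFunctional ζ α (k + 1) (descWedge (momentVec ζ b₀ t) (k + 1)) -
      tauFunctional ζ α (k + 1) (weightDerivation ζ (descWedge (momentVec ζ b₀ t) (k + 1))) ^ 2 =
      -(tauFunctional ζ α (k + 2) (weightDerivation ζ (descWedge (momentVec ζ b₀ t) (k + 2))) *
          tauFunctional ζ α k (descWedge (momentVec ζ b₀ t) k) -
        tauFunctional ζ α (k + 2) (descWedge (momentVec ζ b₀ t) (k + 2)) *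
          tauFunctional ζ α k (weightDerivation ζ (descWedge (momentVec ζ b₀ t) k)) +
        α * tauFunctional ζ α (k + 2) (descWedge (momentVec ζ b₀ t) (k + 2)) *
          tauFunctional ζ α k (descWedge (momentVec ζ b₀ t) k)) by
    linear_combination h + (tauFunctional ζ α (k + 1) (weightDerivation ζ (weightDerivation ζ
        (descWedge (momentVec ζ b₀ t) (k + 1)))) *
        tauFunctional ζ α (k + 1) (descWedge (momentVec ζ b₀ t) (k + 1)) -
      tauFunctional ζ α (k + 1) (weightDerivation ζ (descWedge (momentVec ζ b₀ t) (k + 1))) ^ 2) *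
        hs1 + (tauFunctional ζ α (k + 2)
          (weightDerivation ζ (descWedge (momentVec ζ b₀ t) (k + 2))) *
          tauFunctional ζ α k (descWedge (momentVec ζ b₀ t) k) -
        tauFunctional ζ α (k + 2) (descWedge (momentVec ζ b₀ t) (k + 2)) *
          tauFunctional ζ α k (weightDerivation ζ (descWedge (momentVec ζ b₀ t) k)) +
        α * tauFunctional ζ α (k + 2) (descWedge (momentVec ζ b₀ t) (k + 2)) *
          tauFunctional ζ α k (descWedge (momentVec ζ b₀ t) k)) * hs0
  have hg : ∀ j, weightDerivation 1 (descWedge (momentVec ζ b₀ t) j) =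
      (j : ℝ) • descWedge (momentVec ζ b₀ t) j := weightDerivation_one_descWedge _
  have hg' : weightDerivation 1 (weightDerivation ζ (descWedge (momentVec ζ b₀ t) (k + 1))) =
      ((k : ℝ) + 1) • weightDerivation ζ (descWedge (momentVec ζ b₀ t) (k + 1)) := by
    rw [weightDerivation_descWedge, weightDerivation_ι_mul, weightDerivation_one_descWedge,
      one_mul, mul_smul_comm, add_smul, one_smul, add_comm]
  have hY1 : descWedge (R := ℝ) (momentVec ζ b₀ t) (k + 1) =
      ι ℝ (momentVec ζ b₀ t k) * descWedge (momentVec ζ b₀ t) k := rfl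
  have hY2 : descWedge (R := ℝ) (momentVec ζ b₀ t) (k + 2) =
      ι ℝ (momentVec ζ b₀ t (k + 1)) *
        (ι ℝ (momentVec ζ b₀ t k) * descWedge (momentVec ζ b₀ t) k) := rfl
  rcases Nat.even_or_odd k with hk | hk
  · have hk1 : ¬ Even (k + 1) := by simpa [parity_simps] using hk
    have hk2 : Even (k + 2) := by simpa [parity_simps] using hk
    have plu := plucker_even (cauchyForm_isAlt ζ α) (momentVec ζ b₀ t) k (momentVec ζ b₀ t k)
      (momentVec ζ b₀ t (k + 1)) (powerFunctional ζ 0) (powerFunctional ζ 1)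
    rw [← hY2, ← hY1, ← weightDerivation_descWedge] at plu
    simp only [tauFunctional, hk, hk1, hk2, if_true, if_false, LinearMap.comp_apply]
    rw [pfaffianFunctional_contractLeft_weightDerivation hζ hα (weightDerivation ζ _), hg',
      pfaffianFunctional_contractLeft_weightDerivation hζ hα (descWedge _ (k + 1)), hg,
      pfaffianFunctional_weightDerivation_eq hζ hα (descWedge _ (k + 2)), hg,
      pfaffianFunctional_weightDerivation_eq hζ hα (descWedge _ k), hg]
    rw [pfaffianFunctional_contractLeft_weightDerivation hζ hα (descWedge _ (k + 1)), hg] at plu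
    simp only [map_smul, smul_eq_mul] at plu ⊢
    rw [pfaffianFunctional_contractLeft_weightDerivation hζ hα (descWedge _ (k + 1)), hg]
    simp only [map_smul, smul_eq_mul]
    push_cast at plu ⊢
    linear_combination -plu
  · have hk0 : ¬ Even k := by simpa using hk
    have hk1 : Even (k + 1) := by simpa [parity_simps] using hk
    have hk2 : ¬ Even (k + 2) := by simpa [parity_simps] using hk
    have plu := plucker_odd (cauchyForm_isAlt ζ α) (momentVec ζ b₀ t) k (momentVec ζ b₀ t k)
      (momentVec ζ b₀ t (k + 1)) (powerFunctional ζ 0) (powerFunctional ζ 1)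
    rw [← hY2, ← hY1, ← weightDerivation_descWedge] at plu
    simp only [tauFunctional, hk0, hk1, hk2, if_true, if_false, LinearMap.comp_apply]
    rw [pfaffianFunctional_weightDerivation_eq hζ hα (weightDerivation ζ _), hg',
      pfaffianFunctional_contractLeft_weightDerivation hζ hα (descWedge _ (k + 2)), hg,
      pfaffianFunctional_contractLeft_weightDerivation hζ hα (descWedge _ k), hg]
    have h1 := pfaffianFunctional_weightDerivation_eq hζ hα (descWedge (momentVec ζ b₀ t) (k + 1))
    rw [hg] at h1
    simp only [map_smul, smul_eq_mul] at h1 ⊢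
    push_cast at h1 ⊢
    linear_combination -plu - pfaffianFunctional _ (cauchyForm_isAlt ζ α)
      (weightDerivation ζ (descWedge (momentVec ζ b₀ t) (k + 1))) * h1

end

end Lattice

/-! ### The undeformed tau functions -/

section Undeformed

variable {n : ℕ}

/-- Minor summation: expansion of a product of vectors of `ℝⁿ` in the standard basis. -/
lemma ιMulti_eq_sum_det (k : ℕ) (v : Fin k → Fin n → ℝ) :
    ιMulti ℝ k v = ∑ s : Set.powersetCard (Fin n) k,
      (Matrix.of fun i j => v i (Set.powersetCard.ofFinEmbEquiv.symm s j)).det •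
        ιMulti ℝ k fun i => Pi.single (Set.powersetCard.ofFinEmbEquiv.symm s i) (1 : ℝ) := by
  have h := congrArg Subtype.val
    (((Pi.basisFun ℝ (Fin n)).exteriorPower k).sum_repr (exteriorPower.ιMulti ℝ k v)).symm
  rw [exteriorPower.ιMulti_apply_coe] at h
  rw [h, AddSubmonoidClass.coe_finsetSum]
  refine Finset.sum_congr rfl fun s _ => ?_
  rw [Submodule.coe_smul, exteriorPower.basis_repr_apply, exteriorPower.ιMultiDual_apply_ιMulti,
    exteriorPower.basis_apply, exteriorPower.ιMulti_family, exteriorPower.ιMulti_apply_coe]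
  simp [Function.comp_def]

lemma prod_prod_filter_lt_map {k : ℕ} (φ : Fin k ↪o Fin n) (g : Fin n → Fin n → ℝ) :
    ∏ i ∈ Finset.univ.map φ.toEmbedding, ∏ j ∈ Finset.univ.map φ.toEmbedding with i < j, g i j =
      ∏ i, ∏ j ∈ Finset.Ioi i, g (φ i) (φ j) := by
  rw [Finset.prod_map]
  refine Finset.prod_congr rfl fun i _ => ?_
  rw [Finset.filter_map, Finset.prod_map]
  refine Finset.prod_congr ?_ fun _ _ => rfl
  ext j
  simp

variable {ζ : Fin n → ℝ} (b₀ : Fin n → ℝ) (hζ : ∀ j, 0 < ζ j)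

lemma det_momentVec (t : ℝ) {k : ℕ} (φ : Fin k ↪o Fin n) :
    (Matrix.of fun i j : Fin k => momentVec ζ b₀ t i (φ j)).det =
      (∏ j, b ζ b₀ (φ j) t) * ∏ i, ∏ j ∈ Finset.Ioi i, (ζ (φ j) - ζ (φ i)) := by
  rw [← Matrix.det_vandermonde fun j => ζ (φ j), ← Matrix.det_transpose,
    ← Matrix.det_mul_column]
  congr 1
  ext i j
  simp [momentVec, Matrix.vandermonde, mul_comm]

include hζ

lemma tauFunctional_ιMulti_single (hinj : Function.Injective ζ) {k : ℕ} (φ : Fin k ↪o Fin n) :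
    tauFunctional ζ 0 k (ιMulti ℝ k fun i => Pi.single (φ i) (1 : ℝ)) =
      schurProd fun i => ζ (φ i) := by
  have hx : Function.Injective fun i => ζ (φ i) := hinj.comp φ.injective
  rcases Nat.even_or_odd' k with ⟨m, rfl | rfl⟩
  · rw [tauFunctional, if_pos (by simp)]
    exact pfaffianFunctional_eq_schurProd _ m _ _ hx (fun _ => hζ _)
      fun i j => by simp [cauchyForm_single_single]
  · rw [tauFunctional, if_neg (by simp [parity_simps]), LinearMap.comp_apply]
    exact pfaffianFunctional_contractLeft_eq_schurProd _ m _ _ hx (fun _ => hζ _)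
      (fun i j => by simp [cauchyForm_single_single]) _ fun i => by simp [powerFunctional_single]

theorem tauTilde_zero_eq_tau (hinj : Function.Injective ζ) (k : ℤ) (t : ℝ) :
    tauTilde ζ b₀ 0 k t = tau ζ b₀ k t := by
  rcases lt_or_ge k 0 with hk | hk
  · simp [tauTilde, tau, hk]
  lift k to ℕ using hk
  rw [tauTilde_eq_ιMulti b₀ hζ le_rfl, ιMulti_eq_sum_det, map_sum, tau, if_neg (by omega),
    Int.toNat_natCast, Finset.sum_subtype (p := (· ∈ Set.powersetCard (Fin n) k)) _
      (fun s => by simp [Set.powersetCard.mem_iff])]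
  refine Fintype.sum_congr _ _ fun s => ?_
  obtain ⟨φ, rfl⟩ := Set.powersetCard.ofFinEmbEquiv.surjective s
  have hs : ((Set.powersetCard.ofFinEmbEquiv φ : Set.powersetCard (Fin n) k) : Finset (Fin n)) =
      Finset.univ.map φ.toEmbedding := rfl
  rw [Equiv.symm_apply_apply, map_smul, smul_eq_mul, tauFunctional_ιMulti_single hζ hinj,
    det_momentVec, hs, prod_prod_filter_lt_map φ fun i j => ζ j - ζ i,
    prod_prod_filter_lt_map φ fun i j => ζ j + ζ i, Finset.prod_map, schurProd]
  simp only [Finset.prod_div_distrib]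
  simp only [RelEmbedding.coe_toEmbedding]
  ring

omit hζ in
lemma tauTilde_neg_one (α : ℝ) : tauTilde ζ b₀ α (-1) = fun _ => 0 := by
  funext t; simp [tauTilde]

theorem solvesGeneralizedBToda_tauTilde {α : ℝ} (hα : 0 ≤ α) :
    SolvesGeneralizedBToda n α (tauTilde ζ b₀ α) where
  contDiff k hk _ := by
    rcases hk.eq_or_lt with rfl | hk
    · rw [tauTilde_neg_one]; exact contDiff_const
    lift k to ℕ using (by omega)
    rw [tauTilde_eq_descWedge b₀ hζ hα]
    exact contDiff_descWedge ζ b₀ k _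
  left_boundary t := by rw [tauTilde_neg_one]
  right_boundary t := by
    have h := congrFun (tauTilde_eq_descWedge b₀ hζ hα (n + 1)) t
    rw [descWedge_eq_zero, map_zero] at h
    exact_mod_cast h
  equation k hk _ t := by
    lift k to ℕ using hk
    cases k with
    | zero =>
      have h0 : deriv (tauTilde ζ b₀ α ((0 : ℕ) : ℤ)) = fun _ => 0 := by
        rw [deriv_tauTilde b₀ hζ hα]
        simp [descWedge, weightDerivation_one]
      have h1 : tauTilde ζ b₀ α (((0 : ℕ) : ℤ) - 1) = fun _ => 0 := tauTilde_neg_one b₀ α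
      rw [h0, h1]
      simp
    | succ k =>
      have h := tauTilde_equation b₀ hζ hα k t
      rw [show (((k + 1 : ℕ) : ℤ) + 1) = ((k + 2 : ℕ) : ℤ) by push_cast; ring,
        show (((k + 1 : ℕ) : ℤ) - 1) = (k : ℤ) by push_cast; ring]
      exact h

omit hζ in
lemma solvesGeneralizedBToda_zero_iff (τ : ℤ → ℝ → ℝ) :
    SolvesGeneralizedBToda n 0 τ ↔ SolvesBToda n τ := by
  constructor
  · exact fun h => ⟨h.contDiff, h.left_boundary, h.right_boundary, fun k hk hn t => by
      linear_combination h.equation k hk hn t⟩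
  · exact fun h => ⟨h.contDiff, h.left_boundary, h.right_boundary, fun k hk hn t => by
      linear_combination h.equation k hk hn t⟩

end Undeformed

end BToda

end

theorem mainTheorem8 (n : ℕ) (ζ b₀ : Fin n → ℝ)
    (hζ_pos : ∀ j, 0 < ζ j) (hζ_mono : StrictMono ζ) (hb₀ : ∀ j, 0 < b₀ j) :
    (∀ α : ℝ, 0 ≤ α →
      (∀ (i j : ℕ) (t : ℝ), MeasureTheory.IntegrableOn
        (BToda.integrand ζ b₀ α i j) (BToda.region t)) ∧
      BToda.SolvesGeneralizedBToda n α (BToda.tauTilde ζ b₀ α)) ∧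
    (∀ τ : ℤ → ℝ → ℝ,
      BToda.SolvesGeneralizedBToda n 0 τ ↔ BToda.SolvesBToda n τ) ∧
    (∀ (k : ℤ) (t : ℝ), BToda.tauTilde ζ b₀ 0 k t = BToda.tau ζ b₀ k t) ∧
    BToda.SolvesBToda n (BToda.tau ζ b₀) := by
  have htau := BToda.tauTilde_zero_eq_tau b₀ hζ_pos hζ_mono.injective
  refine ⟨fun α hα => ⟨BToda.integrableOn_integrand b₀ hζ_pos hα,
    BToda.solvesGeneralizedBToda_tauTilde b₀ hζ_pos hα⟩,
    BToda.solvesGeneralizedBToda_zero_iff, htau, ?_⟩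
  rw [← BToda.solvesGeneralizedBToda_zero_iff, ← funext₂ htau]
  exact BToda.solvesGeneralizedBToda_tauTilde b₀ hζ_pos le_rfl
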